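/- **Setting.** Fix layer widths $d_0,d_1,\dots$, a number $r\ge 1$ of random features, an activation $\sigma:\mathbb R\to\mathbb R$ (applied coordinatewise), and let $\sigma_{\mathcal K}(t)=\max(0,t)$ be ReLU. Given weights $\mathbf w^\ell_1,\dots,\mathbf w^\ell_r\in\mathbb R^{d_{\ell-1}}$ and $\mathbf v^\ell_1,\dots,\mathbf v^\ell_{d_\ell}\in\mathbb R^r$ for the layers $1\le \ell\le L$, define $\mathbf f^0(\mathbf x)=\mathbf x\in\mathbb R^{d_0}$, $\boldsymbol\phi^\ell(\mathbf x)=\big(r^{-1/2}\sigma_{\mathcal K}(\sigma(\mathbf f^{\ell-1}(\mathbf x))^T\mathbf w^\ell_i)\big)_{i\le r}$ and $\mathbf f^\ell(\mathbf x)=\big(\boldsymbol\phi^\ell(\mathbf x)^T\mathbf v^\ell_j\big)_{j\le d_\ell}$. Let $\rho>0$; for each $1\le\ell\le L$ the vectors $\mathbf w^\ell_1,\dots,\mathbf w^\ell_r$ are i.i.d. with the law of $\rho\,N(\mathbf 0,\mathbf I)$ on $\mathbb R^{d_{\ell-1}}$; the $\mathbf v^\ell_j$ are arbitrary (possibly random).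 Put $$\hat{\mathcal K}^\ell(\mathbf f,\mathbf f')=\frac1r\sum_{i=1}^r\sigma_{\mathcal K}(\sigma(\mathbf f)^T\mathbf w^\ell_i)\,\sigma_{\mathcal K}(\sigma(\mathbf f')^T\mathbf w^\ell_i),\qquad \mathcal K^\ell(\mathbf f,\mathbf f')=\mathbb E_{\mathbf w\sim\rho N(\mathbf 0,\mathbf I)}\big[\sigma_{\mathcal K}(\sigma(\mathbf f)^T\mathbf w)\,\sigma_{\mathcal K}(\sigma(\mathbf f')^T\mathbf w)\big].$$ **Theorem.** Let $\epsilon_0>0$, $1\le\ell\le L$, $d=d_{\ell-1}$, let $\mathcal M\subset\mathbb R^d$ be compact and let $c_{\mathcal M}$ satisfy $\|\Delta\|_2\le c_{\mathcal M}$ for all $\Delta\in\mathcal M$. There are a constant $c_1>0$ and a parameter $\nu_{\mathcal M}>0$ such that for all $r\ge1$ and all $0<\epsilon\le\epsilon_0$, with probability at least $$1-c_1\,c_{\mathcal M}\,\mathrm{diam}(\mathcal M)^2\exp\Big(-\frac{r\epsilon^2}{8(1+d)\nu_{\mathcal M}^2}\Big),$$ the inequality $$\big|\hat{\mathcal K}^\ell(\mathbf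 f^{\ell-1}(\mathbf x),\mathbf f^{\ell-1}(\mathbf x'))-\mathcal K^\ell(\mathbf f^{\ell-1}(\mathbf x),\mathbf f^{\ell-1}(\mathbf x'))\big|\le\epsilon$$ holds simultaneously for all inputs $\mathbf x,\mathbf x'\in\mathbb R^{d_0}$ for which $\sigma(\mathbf f^{\ell-1}(\mathbf x))$ and $\sigma(\mathbf f^{\ell-1}(\mathbf x'))$ lie in $\mathcal M$ and are not collinear (i.e. are linearly independent). Here $\nu_{\mathcal M}$ depends only on $\mathcal M$ (hence on $d$), $\rho$ and $\epsilon_0$; and $c_1$ is an absolute constant whenever $c_{\mathcal M}\,\mathrm{diam}(\mathcal M)^2\ge1$, and otherwise depends only on $\mathcal M$ and $c_{\mathcal M}$. -/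

import Mathlib

open MeasureTheory ProbabilityTheory
open scoped RealInnerProductSpace

noncomputable section

/-- The rectified linear unit. -/
def relu (t : ℝ) : ℝ := max 0 t

/-- Coordinatewise application of an activation function `σ` to a vector. -/
def applyAct {n : ℕ} (σ : ℝ → ℝ) (f : EuclideanSpace ℝ (Fin n)) : EuclideanSpace ℝ (Fin n) :=
  WithLp.toLp 2 (fun j => σ (f j))

/-- Random feature block with ReLU features: the `i`-th output is `r^{-1/2} relu(uᵀ wᵢ)`. -/
def randomFeatureBlock {n r : ℕ} (w : Fin r → EuclideanSpace ℝ (Fin n))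
    (u : EuclideanSpace ℝ (Fin n)) : EuclideanSpace ℝ (Fin r) :=
  WithLp.toLp 2 (fun i => 1 / Real.sqrt r * relu ⟪u, w i⟫)

/-- Function block: the `j`-th output is `φᵀ vⱼ`. -/
def functionBlock {r m : ℕ} (v : Fin m → EuclideanSpace ℝ (Fin r))
    (φ : EuclideanSpace ℝ (Fin r)) : EuclideanSpace ℝ (Fin m) :=
  WithLp.toLp 2 (fun j => ⟪φ, v j⟫)

/-- The layer maps of the network. Layer `0` is the input, and layer `k + 1` is obtained from
layer `k` by the activation `σ`, then the random feature block with weights `W k`, then the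
function block with weights `V k`. The width of layer `k` is `d k`. -/
def layerMap {r : ℕ} (d : ℕ → ℕ) (σ : ℝ → ℝ)
    (W : (k : ℕ) → Fin r → EuclideanSpace ℝ (Fin (d k)))
    (V : (k : ℕ) → Fin (d (k + 1)) → EuclideanSpace ℝ (Fin r)) :
    (k : ℕ) → EuclideanSpace ℝ (Fin (d 0)) → EuclideanSpace ℝ (Fin (d k))
  | 0, x => x
  | k + 1, x =>
      functionBlock (V k) (randomFeatureBlock (W k) (applyAct σ (layerMap d σ W V k x)))

/-- The law of `ρ g`, where `g` is a standard Gaussian vector in `ℝⁿ`. -/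
def gaussianWeightLaw (ρ : ℝ) (n : ℕ) : Measure (EuclideanSpace ℝ (Fin n)) :=
  (stdGaussian (EuclideanSpace ℝ (Fin n))).map (fun g => ρ • g)

/-- The empirical random feature kernel, as a function of the values `f`, `f'` of the previous
layer: `(1/r) ∑ᵢ relu(σ(f)ᵀ wᵢ) relu(σ(f')ᵀ wᵢ)`. -/
def empiricalKernel {n r : ℕ} (σ : ℝ → ℝ) (w : Fin r → EuclideanSpace ℝ (Fin n))
    (f f' : EuclideanSpace ℝ (Fin n)) : ℝ :=
  1 / (r : ℝ) * ∑ i, relu ⟪applyAct σ f, w i⟫ * relu ⟪applyAct σ f', w i⟫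

/-- The expectation kernel `E_w [relu(σ(f)ᵀ w) relu(σ(f')ᵀ w)]`. -/
def expectedKernel {n : ℕ} (σ : ℝ → ℝ) (ρ : ℝ) (f f' : EuclideanSpace ℝ (Fin n)) : ℝ :=
  ∫ w, relu ⟪applyAct σ f, w⟫ * relu ⟪applyAct σ f', w⟫ ∂(gaussianWeightLaw ρ n)

/-- The random vectors `w i` are independent, each with the law of `ρ N(0, I)`. -/
def IsIIDGaussian {Ω : Type*} [MeasurableSpace Ω] {n r : ℕ} (ρ : ℝ)
    (w : Fin r → Ω → EuclideanSpace ℝ (Fin n)) (μ : Measure Ω) : Prop :=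
  (∀ i, HasLaw (w i) (gaussianWeightLaw ρ n) μ) ∧ iIndepFun w μ

end

/-!
The inequality is a uniform law of large numbers for the functions
`w ↦ relu ⟪u, w⟫ * relu ⟪u', w⟫`, where `(u, u')` runs through a bounded subset of
`ℝᵈ × ℝᵈ`. The event may be chosen from the weights of the layer alone, uniformly in the values
`u, u'`, so neither the earlier layers nor the matrices `V` play any role, and linear independence
of `u, u'` is needed only when `M` has diameter zero, where the probability has to be `1`.

On bounded sets these functions are Lipschitz in `(u, u')` with constant proportional to `‖w‖ ^ 2`
(`abs_relu_inner_mul_sub_le`), and `‖w‖ ^ 2` has an exponential moment by Fernique's theorem.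
Hence the increments between nearby parameters satisfy a Bernstein-type inequality with the
distance of the parameters as scale (`exists_mgf_le_exp_sq`, `measureReal_abs_sum_ge_le`).

A single net of mesh `ε` would cost a factor polynomial in `1 / ε`, which is not allowed in front of
the exponential. Chaining removes it. The unit ball is approximated by the points
`∑_{i < j} 2⁻ⁱ fᵢ`, with the `fᵢ` in a fixed finite `1/2`-net of `N` elements, so that generation `j`
has at most `N ^ (j + 1)` links. A link of generation `j` has length at most `2⁻ʲ` and is allowed a
fluctuation of `2⁻ʲ (j + 1) ε / 4`; these allowances add up to `ε` (`abs_le_of_chain`). Since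
`ε ≤ ε₀`, the link fails with probability at most `2 exp (-(j + 1) β r ε ^ 2)`, so the factor `j + 1`
beats the number of links, and the union bound is a geometric series in `N exp (-β r ε ^ 2)`
(`measureReal_iUnion_le_of_pow`). The factor `N` is finally absorbed into the rate
(`le_four_mul_exp_of_le_mul_exp`), which leaves the absolute constant `4`. The result is
`exists_uniform_deviation_bound`.

The factor `c * diam M ^ 2` of the theorem is harmless when it is at least `1`; when it is smaller
and positive, `c₁` is four times its inverse.
-/

/-! ### Bernstein-type concentration for dominated functions -/

theorem exp_le_one_add_add_sq_mul_exp_abs (x : ℝ) :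
    Real.exp x ≤ 1 + x + x ^ 2 * Real.exp |x| := by
  have h := Complex.norm_exp_sub_sum_le_norm_mul_exp (x : ℂ) 2
  have h1 : Complex.exp x - ∑ m ∈ Finset.range 2, (x : ℂ) ^ m / m.factorial
      = ((Real.exp x - (1 + x) : ℝ) : ℂ) := by
    simp [Finset.sum_range_succ]
  rw [h1, Complex.norm_real, Complex.norm_real, Real.norm_eq_abs, Real.norm_eq_abs, sq_abs] at h
  linarith [le_abs_self (Real.exp x - (1 + x))]

section Concentration

variable {S : Type*} [MeasurableSpace S] {P : Measure S} {Y : S → ℝ} {a : ℝ}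

theorem integrable_of_integrable_exp_mul (ha : 0 < a) (hYm : Measurable Y) (hY0 : ∀ s, 0 ≤ Y s)
    (hint : Integrable (fun s => Real.exp (a * Y s)) P) : Integrable Y P := by
  refine (hint.const_mul a⁻¹).mono' hYm.aestronglyMeasurable (ae_of_all _ fun s => ?_)
  rw [Real.norm_of_nonneg (hY0 s), ← div_eq_inv_mul, le_div_iff₀ ha]
  linarith [Real.add_one_le_exp (a * Y s)]

/-- A function dominated by some `Y` with an exponential moment is, after centering, sub-Gaussian for
small parameters; the constants depend on `Y` only. This is the bound
`exp x ≤ 1 + x + x ^ 2 * exp |x|`, integrated, where the linear term drops out. -/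
theorem exists_mgf_le_exp_sq [IsProbabilityMeasure P] (ha : 0 < a) (hYm : Measurable Y)
    (hY0 : ∀ s, 0 ≤ Y s) (hint : Integrable (fun s => Real.exp (a * Y s)) P) :
    ∃ B > 0, ∃ t₀ > 0, ∀ X : S → ℝ, Measurable X → (∀ s, |X s| ≤ Y s) → ∀ t, |t| ≤ t₀ →
      Integrable (fun s => Real.exp (t * (X s - ∫ z, X z ∂P))) P ∧
      mgf (fun s => X s - ∫ z, X z ∂P) P t ≤ Real.exp (B * t ^ 2) := by
  set m := ∫ z, Y z ∂P
  have hYi : Integrable Y P := integrable_of_integrable_exp_mul ha hYm hY0 hint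
  have hm : 0 ≤ m := integral_nonneg hY0
  have hE : Integrable (fun s => Real.exp (a * (Y s + m))) P := by
    simpa only [mul_add, Real.exp_add] using hint.mul_const (Real.exp (a * m))
  refine ⟨16 / a ^ 2 * ∫ s, Real.exp (a * (Y s + m)) ∂P,
    mul_pos (by positivity) (integral_exp_pos hE), a / 2, by positivity, fun X hX hXY t ht => ?_⟩
  have hXi : Integrable X P := hYi.mono' hX.aestronglyMeasurable (ae_of_all _ hXY)
  set c := ∫ z, X z ∂P
  have hc : |c| ≤ m := (abs_integral_le_integral_abs).trans (integral_mono hXi.abs hYi hXY)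
  have hX' : ∀ s, |X s - c| ≤ Y s + m := fun s => (abs_sub _ _).trans (add_le_add (hXY s) hc)
  have habs : ∀ s, |t * (X s - c)| ≤ a / 2 * (Y s + m) := fun s => by
    rw [abs_mul]; exact mul_le_mul ht (hX' s) (abs_nonneg _) (by positivity)
  have hi : Integrable (fun s => Real.exp (t * (X s - c))) P := by
    refine hE.mono' (by fun_prop) (ae_of_all _ fun s => ?_)
    rw [Real.norm_of_nonneg (Real.exp_pos _).le, Real.exp_le_exp]
    have := add_nonneg (hY0 s) hm
    nlinarith [le_abs_self (t * (X s - c)), habs s]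
  refine ⟨hi, ?_⟩
  have hpt : ∀ s, Real.exp (t * (X s - c)) ≤
      1 + t * (X s - c) + 16 / a ^ 2 * t ^ 2 * Real.exp (a * (Y s + m)) := fun s => by
    have hy := add_nonneg (hY0 s) hm
    set y := Y s + m
    have h1 := exp_le_one_add_add_sq_mul_exp_abs (t * (X s - c))
    have h2 : a / 4 * y ≤ Real.exp (a / 4 * y) := by
      linarith [Real.add_one_le_exp (a / 4 * y)]
    have h3 : y ^ 2 ≤ 16 / a ^ 2 * Real.exp (a / 2 * y) := by
      have h := pow_le_pow_left₀ (by positivity) h2 2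
      rw [← Real.exp_nat_mul] at h
      have e : ((2 : ℕ) : ℝ) * (a / 4 * y) = a / 2 * y := by push_cast; ring
      rw [e] at h
      calc y ^ 2 = 16 / a ^ 2 * (a / 4 * y) ^ 2 := by field_simp; norm_num
        _ ≤ _ := by gcongr
    have h4 : (t * (X s - c)) ^ 2 * Real.exp |t * (X s - c)| ≤
        t ^ 2 * y ^ 2 * Real.exp (a / 2 * y) := by
      rw [mul_pow, ← sq_abs (X s - c)]
      gcongr
      · exact hX' s
      · exact habs s
    have h5 : Real.exp (a * y) = Real.exp (a / 2 * y) * Real.exp (a / 2 * y) := by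
      rw [← Real.exp_add]; congr 1; ring
    have h6 : t ^ 2 * y ^ 2 * Real.exp (a / 2 * y) ≤
        t ^ 2 * (16 / a ^ 2 * Real.exp (a / 2 * y)) * Real.exp (a / 2 * y) := by gcongr
    rw [h5]
    linarith
  have hXc : Integrable (fun s => t * (X s - c)) P := (hXi.sub (integrable_const c)).const_mul t
  have h0 : ∫ s, t * (X s - c) ∂P = 0 := by
    rw [integral_const_mul, integral_sub hXi (integrable_const c)]
    simp [c]
  calc mgf (fun s => X s - c) P t
      ≤ ∫ s, (1 + t * (X s - c) + 16 / a ^ 2 * t ^ 2 * Real.exp (a * (Y s + m))) ∂P :=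
        integral_mono hi (((integrable_const 1).add hXc).add (hE.const_mul _)) hpt
    _ = 1 + 16 / a ^ 2 * t ^ 2 * ∫ s, Real.exp (a * (Y s + m)) ∂P := by
        have e := integral_add ((integrable_const (1 : ℝ)).add hXc)
          (hE.const_mul (16 / a ^ 2 * t ^ 2))
        simp only [Pi.add_apply] at e
        rw [e, integral_add (integrable_const 1) hXc, h0, integral_const_mul]
        simp
    _ ≤ _ := by
        rw [add_comm]
        refine (Real.add_one_le_exp _).trans (Real.exp_le_exp.2 (le_of_eq (by ring)))

variable {Ω : Type*} [MeasurableSpace Ω] {μ : Measure Ω} [IsProbabilityMeasure μ] {r : ℕ}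
  {w : Fin r → Ω → S}

theorem measureReal_sum_ge_le [IsProbabilityMeasure P] (hw : ∀ i, HasLaw (w i) P μ)
    (hind : iIndepFun w μ) {X : S → ℝ} (hX : Measurable X) {t b : ℝ} (ht : 0 ≤ t)
    (hi : Integrable (fun s => Real.exp (t * X s)) P) (hb : mgf X P t ≤ Real.exp b) (τ : ℝ) :
    μ.real {ω | r * τ ≤ ∑ i, X (w i ω)} ≤ Real.exp (r * (b - t * τ)) := by
  have hind' : iIndepFun (fun i => X ∘ w i) μ := hind.comp (fun _ => X) (fun _ => hX)
  have hm : ∀ i, AEMeasurable (X ∘ w i) μ := fun i => hX.comp_aemeasurable (hw i).aemeasurable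
  have hmgf : ∀ i, mgf (X ∘ w i) μ t = mgf X P t := fun i => by
    rw [← (hw i).map_eq, mgf_map (hw i).aemeasurable]
    rw [(hw i).map_eq]; exact hi.aestronglyMeasurable
  have hprod : mgf (∑ i, X ∘ w i) μ t = mgf X P t ^ r := by
    rw [hind'.mgf_sum₀ hm, Finset.prod_congr rfl (fun i _ => hmgf i), Finset.prod_const,
      Finset.card_univ, Fintype.card_fin]
  -- The moment generating function of the sum is a product of positive numbers, whereas the
  -- integral of a non-integrable function is `0`.
  have hint : Integrable (fun ω => Real.exp (t * (∑ i, X ∘ w i) ω)) μ := by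
    refine not_imp_comm.1 integral_undef (ne_of_gt ?_)
    change 0 < mgf (∑ i, X ∘ w i) μ t
    rw [hprod]
    exact pow_pos (mgf_pos hi) r
  have h := measure_ge_le_exp_mul_mgf (μ := μ) (X := ∑ i, X ∘ w i) (r * τ) ht hint
  rw [hprod] at h
  simp only [Finset.sum_apply, Function.comp_apply] at h
  refine h.trans ?_
  calc Real.exp (-t * (r * τ)) * mgf X P t ^ r
      ≤ Real.exp (-t * (r * τ)) * Real.exp b ^ r := by
        gcongr
        exact mgf_nonneg
    _ = _ := by
        rw [← Real.exp_nat_mul, ← Real.exp_add]; congr 1; ring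

theorem measureReal_abs_sum_ge_le [IsProbabilityMeasure P] (hw : ∀ i, HasLaw (w i) P μ)
    (hind : iIndepFun w μ) {X : S → ℝ} (hX : Measurable X) {t b : ℝ} (ht : 0 ≤ t)
    (hi : ∀ u, |u| ≤ t → Integrable (fun s => Real.exp (u * X s)) P)
    (hb : ∀ u, |u| = t → mgf X P u ≤ Real.exp b) (τ : ℝ) :
    μ.real {ω | r * τ ≤ |∑ i, X (w i ω)|} ≤ 2 * Real.exp (r * (b - t * τ)) := by
  have habs : |-t| = t := by rw [abs_neg, abs_of_nonneg ht]
  have h1 := measureReal_sum_ge_le hw hind hX ht (hi t (abs_of_nonneg ht).le)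
    (hb t (abs_of_nonneg ht)) τ
  have h2 := measureReal_sum_ge_le hw hind hX.neg ht (X := -X) (b := b)
    (by simpa using hi (-t) habs.le) (by rw [mgf_neg]; exact hb _ habs) τ
  have hs : {ω | r * τ ≤ |∑ i, X (w i ω)|} ⊆
      {ω | r * τ ≤ ∑ i, X (w i ω)} ∪ {ω | r * τ ≤ ∑ i, (-X) (w i ω)} := fun ω hω => by
    simpa [le_abs] using hω
  linarith [(measureReal_mono hs).trans (measureReal_union_le (μ := μ) _ _)]

end Concentration

/-! ### Chaining over self-similar nets -/

section Chaining

theorem exists_finset_half_net {V : Type*} [NormedAddCommGroup V] [ProperSpace V] :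
    ∃ T : Finset V, T.Nonempty ∧ (∀ f ∈ T, ‖f‖ ≤ 1) ∧
      ∀ u : V, ‖u‖ ≤ 1 → ∃ f ∈ T, ‖u - f‖ ≤ 2⁻¹ := by
  obtain ⟨t, hts, htf, htc⟩ := (isCompact_closedBall (0 : V) 1).finite_cover_balls
    (e := 2⁻¹) (by norm_num)
  have hnet : ∀ u : V, ‖u‖ ≤ 1 → ∃ f ∈ htf.toFinset, ‖u - f‖ ≤ 2⁻¹ := fun u hu => by
    have := htc (mem_closedBall_zero_iff.2 hu)
    simp only [Set.mem_iUnion, Metric.mem_ball, dist_eq_norm] at this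
    obtain ⟨f, hf, huf⟩ := this
    exact ⟨f, htf.mem_toFinset.2 hf, huf.le⟩
  refine ⟨htf.toFinset, ?_, fun f hf => ?_, hnet⟩
  · obtain ⟨f, hf, -⟩ := hnet 0 (by simp)
    exact ⟨f, hf⟩
  · exact mem_closedBall_zero_iff.1 (hts (htf.mem_toFinset.1 hf))

variable {V : Type*} [NormedAddCommGroup V] [NormedSpace ℝ V]

open scoped Classical in
/-- The points `∑_{i < j} 2⁻ⁱ fᵢ` with all `fᵢ` in `T`. If `T` is a `1/2`-net of the closed unit
ball, they form a `2⁻ʲ`-net of it. -/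
noncomputable def chainNet (T : Finset V) : ℕ → Finset V
  | 0 => {0}
  | j + 1 => Finset.image₂ (fun p f => p + (2⁻¹ : ℝ) ^ j • f) (chainNet T j) T

theorem card_chainNet_le (T : Finset V) (j : ℕ) : (chainNet T j).card ≤ T.card ^ j := by
  classical
  induction j with
  | zero => simp [chainNet]
  | succ j ih =>
    rw [chainNet, pow_succ]
    exact (Finset.card_image₂_le _ _ _).trans (Nat.mul_le_mul_right _ ih)

theorem norm_le_of_mem_chainNet {T : Finset V} (hT : ∀ f ∈ T, ‖f‖ ≤ 1) {j : ℕ} :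
    ∀ {p : V}, p ∈ chainNet T j → ‖p‖ ≤ 2 - 2 * (2⁻¹ : ℝ) ^ j := by
  classical
  induction j with
  | zero => simp [chainNet]
  | succ j ih =>
    intro p hp
    rw [chainNet, Finset.mem_image₂] at hp
    obtain ⟨p, hp, f, hf, rfl⟩ := hp
    have h : ‖(2⁻¹ : ℝ) ^ j • f‖ ≤ (2⁻¹ : ℝ) ^ j := by
      rw [norm_smul, Real.norm_of_nonneg (by positivity)]
      exact mul_le_of_le_one_right (by positivity) (hT f hf)
    rw [pow_succ]
    linarith [norm_add_le p ((2⁻¹ : ℝ) ^ j • f), ih hp]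

/-- A function that vanishes at `0` and moves by at most `2⁻ʲ (j + 1) δ` along each link of the
`j`-th generation is bounded by `∑ⱼ 2⁻ʲ (j + 1) δ = 4 δ` on all net points that approximate a
given point of the unit ball. -/
theorem exists_mem_chainNet_abs_le {T : Finset V}
    (hnet : ∀ u : V, ‖u‖ ≤ 1 → ∃ f ∈ T, ‖u - f‖ ≤ 2⁻¹) {Z : V → ℝ} {δ : ℝ} (hδ : 0 ≤ δ)
    (hZ0 : Z 0 = 0)
    (hZ : ∀ j, ∀ p ∈ chainNet T j, ∀ f ∈ T,
      |Z (p + (2⁻¹ : ℝ) ^ j • f) - Z p| ≤ (2⁻¹ : ℝ) ^ j * ((j + 1) * δ))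
    {u : V} (hu : ‖u‖ ≤ 1) (n : ℕ) :
    ∃ p ∈ chainNet T n, ‖u - p‖ ≤ (2⁻¹ : ℝ) ^ n ∧ |Z p| ≤ 4 * δ := by
  classical
  suffices h : ∃ p ∈ chainNet T n, ‖u - p‖ ≤ (2⁻¹ : ℝ) ^ n ∧
      |Z p| ≤ (4 - (2 * n + 4) * (2⁻¹ : ℝ) ^ n) * δ by
    obtain ⟨p, hp, hup, hZp⟩ := h
    refine ⟨p, hp, hup, hZp.trans (mul_le_mul_of_nonneg_right ?_ hδ)⟩
    have : (0 : ℝ) ≤ (2 * n + 4) * (2⁻¹ : ℝ) ^ n := by positivity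
    linarith
  induction n with
  | zero => exact ⟨0, by simp [chainNet], by simpa using hu, by simp [hZ0]⟩
  | succ n ih =>
    obtain ⟨p, hp, hup, hZp⟩ := ih
    set h : ℝ := (2⁻¹ : ℝ) ^ n with hh
    have hpos : 0 < h := by positivity
    have hscale : ‖h⁻¹ • (u - p)‖ ≤ 1 := by
      rw [norm_smul, Real.norm_of_nonneg (by positivity), inv_mul_le_iff₀ hpos, mul_one]
      exact hup
    obtain ⟨f, hf, huf⟩ := hnet _ hscale
    refine ⟨p + h • f, ?_, ?_, ?_⟩
    · rw [chainNet]; exact Finset.mem_image₂_of_mem hp hf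
    · have e : u - (p + h • f) = h • (h⁻¹ • (u - p) - f) := by
        rw [smul_sub, smul_inv_smul₀ hpos.ne']; abel
      rw [e, norm_smul, Real.norm_of_nonneg hpos.le, pow_succ]
      gcongr
    · have h1 := hZ n p hp f hf
      rw [← hh] at h1
      have h2 : |Z (p + h • f)| ≤ |Z (p + h • f) - Z p| + |Z p| := by
        simpa using abs_add_le (Z (p + h • f) - Z p) (Z p)
      rw [pow_succ, ← hh]
      push_cast
      linarith

/-- The chaining bound for a function that is Lipschitz on the ball of radius `2`, with any constant:
continuity passes the bound from the net points to their limits. -/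
theorem abs_le_of_chain {T : Finset V} (hT : ∀ f ∈ T, ‖f‖ ≤ 1)
    (hnet : ∀ u : V, ‖u‖ ≤ 1 → ∃ f ∈ T, ‖u - f‖ ≤ 2⁻¹) {Z : V → ℝ} {δ : ℝ} (hδ : 0 ≤ δ)
    (hZ0 : Z 0 = 0)
    (hZ : ∀ j, ∀ p ∈ chainNet T j, ∀ f ∈ T,
      |Z (p + (2⁻¹ : ℝ) ^ j • f) - Z p| ≤ (2⁻¹ : ℝ) ^ j * ((j + 1) * δ))
    {Λ : ℝ} (hΛ0 : 0 ≤ Λ) (hΛ : ∀ a b, ‖a‖ ≤ 2 → ‖b‖ ≤ 2 → |Z a - Z b| ≤ Λ * ‖a - b‖)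
    {u : V} (hu : ‖u‖ ≤ 1) : |Z u| ≤ 4 * δ := by
  have hlim : Filter.Tendsto (fun n : ℕ => 4 * δ + Λ * (2⁻¹ : ℝ) ^ n) Filter.atTop
      (nhds (4 * δ + Λ * 0)) :=
    ((tendsto_pow_atTop_nhds_zero_of_lt_one (by norm_num) (by norm_num)).const_mul Λ).const_add _
  rw [mul_zero, add_zero] at hlim
  refine ge_of_tendsto' hlim fun n => ?_
  obtain ⟨p, hp, hup, hZp⟩ := exists_mem_chainNet_abs_le hnet hδ hZ0 hZ hu n
  have hp2 : ‖p‖ ≤ 2 := by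
    have := norm_le_of_mem_chainNet hT hp
    have : (0 : ℝ) < (2⁻¹ : ℝ) ^ n := by positivity
    linarith
  have h1 := (hΛ u p (by linarith) hp2).trans (mul_le_mul_of_nonneg_left hup hΛ0)
  have h2 : |Z u| ≤ |Z u - Z p| + |Z p| := by simpa using abs_add_le (Z u - Z p) (Z p)
  linarith

/-- Summing the failure probabilities of all links of the chain. -/
theorem measureReal_iUnion_le_of_pow {Ω : Type*} [MeasurableSpace Ω] {μ : Measure Ω}
    [IsFiniteMeasure μ] {A : ℕ → Set Ω} {q : ℝ} (hq0 : 0 ≤ q) (hq : q ≤ 1 / 2)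
    (hA : ∀ j, μ.real (A j) ≤ 2 * q ^ (j + 1)) : μ.real (⋃ j, A j) ≤ 4 * q := by
  have hs : HasSum (fun j : ℕ => 2 * q ^ (j + 1)) (2 * q * (1 - q)⁻¹) := by
    simpa only [pow_succ', ← mul_assoc] using
      (hasSum_geometric_of_lt_one hq0 (by linarith)).mul_left (2 * q)
  refine ENNReal.toReal_le_of_le_ofReal (by positivity) ?_
  calc μ (⋃ j, A j) ≤ ∑' j, μ (A j) := measure_iUnion_le A
    _ ≤ ∑' j, ENNReal.ofReal (2 * q ^ (j + 1)) := ENNReal.tsum_le_tsum fun j => by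
        rw [← ofReal_measureReal]; exact ENNReal.ofReal_le_ofReal (hA j)
    _ = ENNReal.ofReal (2 * q * (1 - q)⁻¹) := by
        rw [← ENNReal.ofReal_tsum_of_nonneg (fun j => by positivity) hs.summable, hs.tsum_eq]
    _ ≤ ENNReal.ofReal (4 * q) := by
        refine ENNReal.ofReal_le_ofReal ?_
        rw [← div_eq_mul_inv, div_le_iff₀ (by linarith)]
        nlinarith

/-- Bounding a probability by `4 N e^{-x}` when `N e^{-x} ≤ 1 / 2` already gives a bound with the
absolute constant `4` in front, at the price of a worse rate: the rate is chosen so that the new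
bound is trivial in the range where the old one says nothing. -/
theorem le_four_mul_exp_of_le_mul_exp {N x y : ℝ} (hN : 1 ≤ N) (hx : 0 ≤ x) (hy1 : y ≤ 1)
    (h : N * Real.exp (-x) ≤ 1 / 2 → y ≤ 4 * (N * Real.exp (-x))) :
    y ≤ 4 * Real.exp (-(x / (2 + 2 * Real.log (2 * N)))) := by
  have hlog : 0 ≤ Real.log (2 * N) := Real.log_nonneg (by linarith)
  set l := Real.log (2 * N) with hl
  have hel : Real.exp l = 2 * N := Real.exp_log (by linarith)
  rcases le_total (2 * l) x with hxl | hxl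
  · have h1 : N * Real.exp (-x) ≤ 1 / 2 * Real.exp (-(x / 2)) := by
      have : N = 1 / 2 * Real.exp l := by rw [hel]; ring
      rw [this, mul_assoc, ← Real.exp_add]
      gcongr
      linarith
    have h2 : Real.exp (-(x / 2)) ≤ 1 := Real.exp_le_one_iff.2 (by linarith)
    have h3 : Real.exp (-(x / 2)) ≤ Real.exp (-(x / (2 + 2 * l))) := by
      gcongr
      linarith
    have := h (by linarith)
    linarith [Real.exp_pos (-(x / (2 + 2 * l)))]
  · have h1 : Real.exp (-1) ≤ Real.exp (-(x / (2 + 2 * l))) := by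
      gcongr
      rw [div_le_one (by linarith)]
      linarith
    have h2 : 1 / 4 ≤ Real.exp (-1) := by
      rw [Real.exp_neg, one_div]
      gcongr
      linarith [Real.exp_one_lt_d9]
    linarith

end Chaining

/-! ### The uniform law of large numbers with a Gaussian tail -/

/-- Let `H v` be a family of functions, indexed by a finite-dimensional space, that is Lipschitz in `v`
on a ball with a random Lipschitz constant `Y` having an exponential moment. Then the empirical
means of `H v` over `r` independent samples deviate from their expectations by at most `ε`,
simultaneously for all `v` in the unit ball, outside an event of probability
`4 * exp (-r * ε ^ 2 / K)`. The radius `2` in the Lipschitz hypothesis leaves room for the chains, whose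
points may leave the unit ball. -/
theorem exists_uniform_deviation_bound {V S : Type*} [NormedAddCommGroup V] [NormedSpace ℝ V]
    [ProperSpace V] [MeasurableSpace S] {P : Measure S} [IsProbabilityMeasure P]
    {H : V → S → ℝ} {Y : S → ℝ} {a ε₀ : ℝ} (ha : 0 < a) (hε₀ : 0 < ε₀)
    (hYm : Measurable Y) (hY0 : ∀ s, 0 ≤ Y s)
    (hint : Integrable (fun s => Real.exp (a * Y s)) P)
    (hHm : ∀ v, Measurable (H v)) (hH0 : ∀ s, H 0 s = 0)
    (hH : ∀ u v s, ‖u‖ ≤ 2 → ‖v‖ ≤ 2 → |H u s - H v s| ≤ ‖u - v‖ * Y s) :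
    ∃ K > 0, ∀ {Ω : Type*} [MeasurableSpace Ω] (μ : Measure Ω) [IsProbabilityMeasure μ]
      (r : ℕ) (w : Fin r → Ω → S), (∀ i, HasLaw (w i) P μ) → iIndepFun w μ →
      ∀ ε, 0 < ε → ε ≤ ε₀ →
        ∃ G : Set Ω, MeasurableSet G ∧ 1 - 4 * Real.exp (-(r * ε ^ 2 / K)) ≤ μ.real G ∧
          ∀ ω ∈ G, ∀ u, ‖u‖ ≤ 1 → |∑ i, (H u (w i ω) - ∫ s, H u s ∂P)| ≤ r * ε := by
  obtain ⟨B, hB, t₀, ht₀, hmgf⟩ := exists_mgf_le_exp_sq ha hYm hY0 hint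
  obtain ⟨T, hTne, hT1, hTnet⟩ := exists_finset_half_net (V := V)
  have hYi : Integrable Y P := integrable_of_integrable_exp_mul ha hYm hY0 hint
  have hHi : ∀ v, ‖v‖ ≤ 2 → Integrable (H v) P := fun v hv =>
    (hYi.const_mul ‖v‖).mono' (hHm v).aestronglyMeasurable (ae_of_all _ fun s => by
      simpa [hH0] using hH v 0 s hv (by simp))
  have hN : (1 : ℝ) ≤ T.card := by exact_mod_cast hTne.card_pos
  -- The loss in the rate when the number of links is absorbed into the exponential.
  set l := 2 + 2 * Real.log (2 * T.card) with hl
  have hlpos : 0 < l := by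
    have := Real.log_nonneg (x := 2 * T.card) (by linarith)
    linarith
  -- The same Chernoff parameter `α ε` serves for the links of all generations.
  set α := min (t₀ / ε₀) (1 / (8 * B)) with hα
  have hαpos : 0 < α := by positivity
  have hα1 : α * ε₀ ≤ t₀ := (le_div_iff₀ hε₀).1 (min_le_left _ _)
  have hα2 : B * α ≤ 1 / 8 := by
    have h := (le_div_iff₀ (by positivity)).1 (min_le_right (t₀ / ε₀) (1 / (8 * B)))
    rw [← hα] at h
    linarith
  refine ⟨8 * l / α, by positivity, fun {Ω} _ μ _ r w hw hind ε hε hεε₀ => ?_⟩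
  -- The rescaled increment of `H` along a link of the `j`-th generation.
  let X : ℕ → V → V → S → ℝ := fun j p f s =>
    (2 : ℝ) ^ j * (H (p + (2⁻¹ : ℝ) ^ j • f) s - H p s)
  let A : ℕ → V → V → Set Ω := fun j p f =>
    {ω | r * ((j + 1) * (ε / 4)) ≤ |∑ i, (X j p f (w i ω) - ∫ s, X j p f s ∂P)|}
  let bad : Set Ω := ⋃ j : ℕ, ⋃ x ∈ chainNet T j ×ˢ T, A j x.1 x.2
  have hnorm : ∀ j, ∀ p ∈ chainNet T j, ∀ f ∈ T,
      ‖p‖ ≤ 2 ∧ ‖p + (2⁻¹ : ℝ) ^ j • f‖ ≤ 2 := fun j p hp f hf => by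
    have h1 := norm_le_of_mem_chainNet hT1 hp
    have h2 : ‖(2⁻¹ : ℝ) ^ j • f‖ ≤ (2⁻¹ : ℝ) ^ j := by
      rw [norm_smul, Real.norm_of_nonneg (by positivity)]
      exact mul_le_of_le_one_right (by positivity) (hT1 f hf)
    have h3 : (0 : ℝ) < (2⁻¹ : ℝ) ^ j := by positivity
    exact ⟨by linarith, by linarith [norm_add_le p ((2⁻¹ : ℝ) ^ j • f)]⟩
  have hA : ∀ j, ∀ p ∈ chainNet T j, ∀ f ∈ T,
      μ.real (A j p f) ≤ 2 * Real.exp (-(r * ε ^ 2 * (α / 8))) ^ (j + 1) := fun j p hp f hf => by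
    obtain ⟨hp2, hpf2⟩ := hnorm j p hp f hf
    have hXm : Measurable (X j p f) := ((hHm _).sub (hHm _)).const_mul _
    have hXY : ∀ s, |X j p f s| ≤ Y s := fun s => by
      have h := hH _ _ s hpf2 hp2
      rw [add_sub_cancel_left, norm_smul, Real.norm_of_nonneg (by positivity)] at h
      simp only [X]
      rw [abs_mul, abs_of_nonneg (by positivity : (0 : ℝ) ≤ 2 ^ j)]
      calc (2 : ℝ) ^ j * |H (p + (2⁻¹ : ℝ) ^ j • f) s - H p s|
          ≤ (2 : ℝ) ^ j * ((2⁻¹ : ℝ) ^ j * 1 * Y s) := by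
            gcongr
            refine h.trans ?_
            gcongr
            · exact hY0 s
            · exact hT1 f hf
        _ = Y s := by rw [mul_one, ← mul_assoc, ← mul_pow]; norm_num
    have hαε : α * ε ≤ t₀ := (mul_le_mul_of_nonneg_left hεε₀ hαpos.le).trans hα1
    have h := measureReal_abs_sum_ge_le hw hind (hXm.sub_const (∫ s, X j p f s ∂P))
      (t := α * ε) (b := B * (α * ε) ^ 2) (by positivity)
      (fun u hu => (hmgf _ hXm hXY u (hu.trans hαε)).1)
      (fun u hu => by
        have h := (hmgf _ hXm hXY u (hu.le.trans hαε)).2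
        rwa [← sq_abs u, hu] at h) ((j + 1) * (ε / 4))
    refine h.trans ?_
    rw [← Real.exp_nat_mul]
    refine mul_le_mul_of_nonneg_left (Real.exp_le_exp.2 ?_) zero_le_two
    have h1 : B * (α * ε) ^ 2 ≤ α * ε ^ 2 / 8 * (j + 1) := by
      have e : B * (α * ε) ^ 2 = B * α * (α * ε ^ 2) := by ring
      have : (0 : ℝ) < α * ε ^ 2 := by positivity
      have : (0 : ℝ) ≤ α * ε ^ 2 / 8 * j := by positivity
      rw [e]
      nlinarith
    calc r * (B * (α * ε) ^ 2 - α * ε * ((j + 1) * (ε / 4)))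
        ≤ r * (α * ε ^ 2 / 8 * (j + 1) - α * ε * ((j + 1) * (ε / 4))) := by gcongr
      _ = _ := by push_cast; ring
  -- The `w i` are only almost everywhere measurable, so `bad` need not be measurable.
  refine ⟨(toMeasurable μ bad)ᶜ, (measurableSet_toMeasurable μ bad).compl, ?_, ?_⟩
  · have hbad : μ.real bad ≤ 4 * Real.exp (-(r * ε ^ 2 * (α / 8) / l)) := by
      refine le_four_mul_exp_of_le_mul_exp hN (by positivity) measureReal_le_one fun hq => ?_
      refine measureReal_iUnion_le_of_pow (by positivity) hq fun j => ?_
      refine (measureReal_biUnion_finset_le _ _).trans ?_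
      calc ∑ x ∈ chainNet T j ×ˢ T, μ.real (A j x.1 x.2)
          ≤ (chainNet T j ×ˢ T).card • (2 * Real.exp (-(r * ε ^ 2 * (α / 8))) ^ (j + 1)) :=
            Finset.sum_le_card_nsmul _ _ _ fun x hx =>
              hA j _ (Finset.mem_product.1 hx).1 _ (Finset.mem_product.1 hx).2
        _ ≤ (T.card : ℝ) ^ (j + 1) * (2 * Real.exp (-(r * ε ^ 2 * (α / 8))) ^ (j + 1)) := by
            rw [nsmul_eq_mul, Finset.card_product]
            gcongr
            exact_mod_cast (Nat.mul_le_mul_right _ (card_chainNet_le T j)).trans_eq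
              (pow_succ _ _).symm
        _ = _ := by rw [mul_pow]; ring
    have e : μ.real (toMeasurable μ bad) = μ.real bad := by
      simp only [measureReal_def, measure_toMeasurable]
    rw [probReal_compl_eq_one_sub (measurableSet_toMeasurable μ bad), e]
    have e2 : r * ε ^ 2 * (α / 8) / l = r * ε ^ 2 / (8 * l / α) := by field_simp
    rw [e2] at hbad
    linarith
  · intro ω hω u hu
    have hωb : ω ∉ bad := fun h => hω (subset_toMeasurable μ bad h)
    have hδ : r * ε = 4 * (r * (ε / 4)) := by ring
    rw [hδ]
    have hYint : 0 ≤ ∫ s, Y s ∂P := integral_nonneg hY0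
    refine abs_le_of_chain (Z := fun v => ∑ i, (H v (w i ω) - ∫ s, H v s ∂P)) hT1 hTnet
      (by positivity) (by simp [hH0]) (fun j p hp f hf => ?_)
      (Λ := ∑ i, (Y (w i ω) + ∫ s, Y s ∂P))
      (Finset.sum_nonneg fun i _ => add_nonneg (hY0 _) hYint) (fun x y hx hy => ?_) hu
    · obtain ⟨hp2, hpf2⟩ := hnorm j p hp f hf
      have hlt : |∑ i, (X j p f (w i ω) - ∫ s, X j p f s ∂P)| < r * ((j + 1) * (ε / 4)) := by
        by_contra hcon
        refine hωb ?_
        simp only [bad, Set.mem_iUnion]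
        exact ⟨j, (p, f), Finset.mem_product.2 ⟨hp, hf⟩, not_lt.1 hcon⟩
      have e : ∑ i, (X j p f (w i ω) - ∫ s, X j p f s ∂P) = (2 : ℝ) ^ j *
          (∑ i, (H (p + (2⁻¹ : ℝ) ^ j • f) (w i ω) - ∫ s, H (p + (2⁻¹ : ℝ) ^ j • f) s ∂P) -
            ∑ i, (H p (w i ω) - ∫ s, H p s ∂P)) := by
        rw [← Finset.sum_sub_distrib, Finset.mul_sum]
        refine Finset.sum_congr rfl fun i _ => ?_
        simp only [X]
        rw [integral_const_mul, integral_sub (hHi _ hpf2) (hHi _ hp2)]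
        ring
      rw [e, abs_mul, abs_of_nonneg (by positivity : (0 : ℝ) ≤ 2 ^ j)] at hlt
      have e2 : (2⁻¹ : ℝ) ^ j * ((j + 1) * (r * (ε / 4))) = r * ((j + 1) * (ε / 4)) / 2 ^ j := by
        rw [inv_pow]; ring
      rw [e2, le_div_iff₀ (by positivity)]
      linarith
    · rw [← Finset.sum_sub_distrib, Finset.sum_mul]
      refine (Finset.abs_sum_le_sum_abs _ _).trans (Finset.sum_le_sum fun i _ => ?_)
      have h1 := hH x y (w i ω) hx hy
      have h2 : |∫ s, H x s ∂P - ∫ s, H y s ∂P| ≤ ‖x - y‖ * ∫ s, Y s ∂P := by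
        rw [← integral_sub (hHi x hx) (hHi y hy), ← integral_const_mul]
        exact abs_integral_le_integral_abs.trans
          (integral_mono ((hHi x hx).sub (hHi y hy)).abs (hYi.const_mul _)
            fun s => hH x y s hx hy)
      have e : H x (w i ω) - ∫ s, H x s ∂P - (H y (w i ω) - ∫ s, H y s ∂P) =
          (H x (w i ω) - H y (w i ω)) - (∫ s, H x s ∂P - ∫ s, H y s ∂P) := by ring
      rw [e]
      refine (abs_sub _ _).trans ?_
      linarith

/-! ### The random feature kernel -/

theorem abs_relu_sub_relu_le (s t : ℝ) : |relu s - relu t| ≤ |s - t| := by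
  simpa [relu, max_comm] using abs_max_sub_max_le_abs s t 0

theorem abs_relu_le (s : ℝ) : |relu s| ≤ |s| := by
  simpa [relu] using abs_relu_sub_relu_le s 0

theorem measurable_relu : Measurable relu := by
  unfold relu; fun_prop

instance isGaussian_gaussianWeightLaw (ρ : ℝ) (n : ℕ) : IsGaussian (gaussianWeightLaw ρ n) :=
  isGaussian_map (μ := stdGaussian (EuclideanSpace ℝ (Fin n)))
    (ρ • ContinuousLinearMap.id ℝ (EuclideanSpace ℝ (Fin n)))

/-- The product of two ReLU features is Lipschitz in the pair of feature directions, on bounded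
sets, with a constant that is quadratic in the weight. -/
theorem abs_relu_inner_mul_sub_le {E : Type*} [NormedAddCommGroup E] [InnerProductSpace ℝ E]
    {R : ℝ} {a b : E × E} (ha : ‖a‖ ≤ 2) (hb : ‖b‖ ≤ 2) (w : E) :
    |relu ⟪R • a.1, w⟫ * relu ⟪R • a.2, w⟫ - relu ⟪R • b.1, w⟫ * relu ⟪R • b.2, w⟫| ≤
      ‖a - b‖ * (4 * R ^ 2 * ‖w‖ ^ 2) := by
  have hin : ∀ v : E, |⟪R • v, w⟫| ≤ ‖v‖ * (|R| * ‖w‖) := fun v => by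
    refine (abs_real_inner_le_norm _ _).trans (le_of_eq ?_)
    rw [norm_smul, Real.norm_eq_abs]; ring
  have hlip : ∀ u v : E, |relu ⟪R • u, w⟫ - relu ⟪R • v, w⟫| ≤ ‖u - v‖ * (|R| * ‖w‖) :=
    fun u v => by
      refine (abs_relu_sub_relu_le _ _).trans ?_
      rw [← inner_sub_left, ← smul_sub]
      exact hin _
  have hbd : ∀ v : E, ‖v‖ ≤ 2 → |relu ⟪R • v, w⟫| ≤ 2 * (|R| * ‖w‖) := fun v hv =>
    (abs_relu_le _).trans ((hin v).trans (by gcongr))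
  set x := relu ⟪R • a.1, w⟫
  set x' := relu ⟪R • a.2, w⟫
  set y := relu ⟪R • b.1, w⟫
  set y' := relu ⟪R • b.2, w⟫
  have h1 : |x - y| ≤ ‖a - b‖ * (|R| * ‖w‖) := (hlip _ _).trans (by
    gcongr; exact norm_fst_le (a - b))
  have h2 : |x' - y'| ≤ ‖a - b‖ * (|R| * ‖w‖) := (hlip _ _).trans (by
    gcongr; exact norm_snd_le (a - b))
  have h3 : |x'| ≤ 2 * (|R| * ‖w‖) := hbd _ ((norm_snd_le a).trans ha)
  have h4 : |y| ≤ 2 * (|R| * ‖w‖) := hbd _ ((norm_fst_le b).trans hb)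
  have e : x * x' - y * y' = (x - y) * x' + y * (x' - y') := by ring
  rw [e]
  calc |(x - y) * x' + y * (x' - y')| ≤ |x - y| * |x'| + |y| * |x' - y'| := by
        rw [← abs_mul, ← abs_mul]; exact abs_add_le _ _
    _ ≤ ‖a - b‖ * (|R| * ‖w‖) * (2 * (|R| * ‖w‖)) +
        2 * (|R| * ‖w‖) * (‖a - b‖ * (|R| * ‖w‖)) := by gcongr
    _ = _ := by rw [← sq_abs R]; ring

/-- Uniform convergence of the random feature kernel on the ball of radius `R`. The event depends
on the weights only, and serves all activations and all layer values at once. -/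
theorem exists_kernel_deviation_bound {ρ ε₀ : ℝ} (hε₀ : 0 < ε₀) (n : ℕ) {R : ℝ} (hR : 0 < R) :
    ∃ K > 0, ∀ {Ω : Type*} [MeasurableSpace Ω] (μ : Measure Ω) [IsProbabilityMeasure μ]
      (r : ℕ) (w : Fin r → Ω → EuclideanSpace ℝ (Fin n)), 0 < r → IsIIDGaussian ρ w μ →
      ∀ ε, 0 < ε → ε ≤ ε₀ →
        ∃ G : Set Ω, MeasurableSet G ∧ 1 - 4 * Real.exp (-(r * ε ^ 2 / K)) ≤ μ.real G ∧
          ∀ ω ∈ G, ∀ (σ : ℝ → ℝ) (f f' : EuclideanSpace ℝ (Fin n)),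
            ‖applyAct σ f‖ ≤ R → ‖applyAct σ f'‖ ≤ R →
            |empiricalKernel σ (fun i => w i ω) f f' - expectedKernel σ ρ f f'| ≤ ε := by
  obtain ⟨c, hc, hint⟩ := IsGaussian.exists_integrable_exp_sq (gaussianWeightLaw ρ n)
  let E := EuclideanSpace ℝ (Fin n)
  obtain ⟨K, hK, h⟩ := exists_uniform_deviation_bound (V := E × E) (P := gaussianWeightLaw ρ n)
    (H := fun a w => relu ⟪R • a.1, w⟫ * relu ⟪R • a.2, w⟫)
    (Y := fun w => 4 * R ^ 2 * ‖w‖ ^ 2) (a := c / (4 * R ^ 2)) (by positivity) hε₀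
    (by fun_prop) (fun w => by positivity)
    (by
      refine hint.congr (ae_of_all _ fun w => ?_)
      simp only
      congr 1
      field_simp)
    (fun v => (measurable_relu.comp (by fun_prop)).mul (measurable_relu.comp (by fun_prop)))
    (fun w => by simp [relu]) (fun u v w hu hv => abs_relu_inner_mul_sub_le hu hv w)
  refine ⟨K, hK, fun μ _ r w hr hw ε hε hεε₀ => ?_⟩
  obtain ⟨G, hGm, hGp, hG⟩ := h μ r w hw.1 hw.2 ε hε hεε₀
  refine ⟨G, hGm, hGp, fun ω hω σ f f' hf hf' => ?_⟩
  have hscale : ∀ v : E, ‖v‖ ≤ R → ‖R⁻¹ • v‖ ≤ 1 := fun v hv => by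
    rwa [norm_smul, Real.norm_of_nonneg (by positivity), inv_mul_le_iff₀ hR, mul_one]
  have hr' : (0 : ℝ) < r := by exact_mod_cast hr
  have h1 := hG ω hω (R⁻¹ • applyAct σ f, R⁻¹ • applyAct σ f')
    (max_le (hscale _ hf) (hscale _ hf'))
  simp only [smul_inv_smul₀ hR.ne'] at h1
  change |∑ i, (_ - expectedKernel σ ρ f f')| ≤ _ at h1
  rw [Finset.sum_sub_distrib, Finset.sum_const, Finset.card_univ, Fintype.card_fin,
    nsmul_eq_mul] at h1
  rw [empiricalKernel, one_div, ← div_eq_inv_mul, div_sub' hr'.ne', abs_div, abs_of_pos hr',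
    div_le_iff₀ hr', mul_comm ε]
  exact h1

/-! ### The network -/

theorem theorem1 :
    -- `c₁ n M c` is an absolute constant as soon as `1 ≤ c * diam(M)^2`
    ∃ (C : ℝ) (c₁ : (n : ℕ) → Set (EuclideanSpace ℝ (Fin n)) → ℝ → ℝ), 0 < C ∧
      (∀ n M c, 0 < c₁ n M c ∧ (1 ≤ c * Metric.diam M ^ 2 → c₁ n M c = C)) ∧
      ∀ ρ : ℝ, 0 < ρ → ∀ ε₀ : ℝ, 0 < ε₀ →
        ∃ ν : (n : ℕ) → Set (EuclideanSpace ℝ (Fin n)) → ℝ, (∀ n M, 0 < ν n M) ∧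
          ∀ (L r : ℕ) (d : ℕ → ℕ) (σ : ℝ → ℝ), 0 < r →
          ∀ {Ω : Type*} [MeasurableSpace Ω] (μ : Measure Ω) [IsProbabilityMeasure μ]
            (W : Ω → (k : ℕ) → Fin r → EuclideanSpace ℝ (Fin (d k)))
            (V : Ω → (k : ℕ) → Fin (d (k + 1)) → EuclideanSpace ℝ (Fin r)),
            (∀ k < L, IsIIDGaussian ρ (fun i ω => W ω k i) μ) →
          -- `k = ℓ - 1` for a layer `1 ≤ ℓ ≤ L`
          ∀ k < L, ∀ (M : Set (EuclideanSpace ℝ (Fin (d k)))) (cM : ℝ),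
            IsCompact M → (∀ Δ ∈ M, ‖Δ‖ ≤ cM) →
          ∀ ε : ℝ, 0 < ε → ε ≤ ε₀ →
            ∃ G : Set Ω, MeasurableSet G ∧
              1 - c₁ (d k) M cM * cM * Metric.diam M ^ 2 *
                  Real.exp (-(r * ε ^ 2) / (8 * (1 + d k) * ν (d k) M ^ 2)) ≤ μ.real G ∧
              ∀ ω ∈ G, ∀ x x' : EuclideanSpace ℝ (Fin (d 0)),
                applyAct σ (layerMap d σ (W ω) (V ω) k x) ∈ M →
                applyAct σ (layerMap d σ (W ω) (V ω) k x') ∈ M →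
                LinearIndependent ℝ ![applyAct σ (layerMap d σ (W ω) (V ω) k x),
                  applyAct σ (layerMap d σ (W ω) (V ω) k x')] →
                |empiricalKernel σ (W ω k) (layerMap d σ (W ω) (V ω) k x)
                    (layerMap d σ (W ω) (V ω) k x') -
                  expectedKernel σ ρ (layerMap d σ (W ω) (V ω) k x)
                    (layerMap d σ (W ω) (V ω) k x')| ≤ ε := by
  refine ⟨4, fun n M c => 4 * max 1 (c * Metric.diam M ^ 2)⁻¹, by norm_num, fun n M c =>
    ⟨by positivity, fun h => by
      dsimp only
      rw [max_eq_left (inv_le_one_of_one_le₀ h), mul_one]⟩, fun ρ _ ε₀ hε₀ => ?_⟩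
  have hR : ∀ (n : ℕ) (M : Set (EuclideanSpace ℝ (Fin n))), ∃ R > 0,
      IsCompact M → ∀ Δ ∈ M, ‖Δ‖ ≤ R := fun n M => by
    by_cases hM : IsCompact M
    · obtain ⟨R, hR, h⟩ := hM.isBounded.exists_pos_norm_le
      exact ⟨R, hR, fun _ => h⟩
    · exact ⟨1, one_pos, fun h => absurd h hM⟩
  choose R hRpos hR using hR
  choose K hKpos hK using fun (n : ℕ) (M : Set (EuclideanSpace ℝ (Fin n))) =>
    exists_kernel_deviation_bound (ρ := ρ) hε₀ n (hRpos n M)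
  refine ⟨fun n M => √(K n M), fun n M => Real.sqrt_pos.2 (hKpos n M), ?_⟩
  intro L r d σ hr Ω _ μ _ W V hW k hk M cM hM hcM ε hε hεε₀
  -- A nonpositive prefactor makes the probability bound at least `1`, so this case is separate.
  by_cases hdiam : Metric.diam M = 0
  · -- A set of diameter zero contains no two linearly independent vectors.
    refine ⟨Set.univ, MeasurableSet.univ, by simp [hdiam], fun ω _ x x' hx hx' hind => ?_⟩
    have h0 := Metric.dist_le_diam_of_mem hM.isBounded hx hx'
    rw [hdiam] at h0
    have h1 := hind.injective (a₁ := 0) (a₂ := 1) (by simpa using dist_le_zero.1 h0)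
    exact absurd h1 (by decide)
  have hdiam' : 0 < Metric.diam M := lt_of_le_of_ne Metric.diam_nonneg (Ne.symm hdiam)
  obtain ⟨G, hGm, hGp, hG⟩ := hK (d k) M μ r (fun i ω => W ω k i) hr (hW k hk) ε hε hεε₀
  refine ⟨G, hGm, le_trans ?_ hGp, fun ω hω x x' hx hx' _ =>
    hG ω hω σ _ _ (hR _ M hM _ hx) (hR _ M hM _ hx')⟩
  have hcM0 : 0 < cM := by
    by_contra hneg
    refine hdiam (Metric.diam_subsingleton fun a ha b hb => ?_)
    rw [norm_le_zero_iff.1 ((hcM a ha).trans (not_lt.1 hneg)),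
      norm_le_zero_iff.1 ((hcM b hb).trans (not_lt.1 hneg))]
  have ht : 0 < cM * Metric.diam M ^ 2 := by positivity
  have hpre : 4 ≤ 4 * max 1 (cM * Metric.diam M ^ 2)⁻¹ * cM * Metric.diam M ^ 2 := by
    calc (4 : ℝ) = 4 * (cM * Metric.diam M ^ 2)⁻¹ * (cM * Metric.diam M ^ 2) := by
          rw [mul_assoc, inv_mul_cancel₀ ht.ne', mul_one]
      _ ≤ 4 * max 1 (cM * Metric.diam M ^ 2)⁻¹ * (cM * Metric.diam M ^ 2) := by
          gcongr
          exact le_max_right _ _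
      _ = _ := by ring
  have hexp : Real.exp (-(r * ε ^ 2 / K (d k) M)) ≤
      Real.exp (-(r * ε ^ 2) / (8 * (1 + d k) * √(K (d k) M) ^ 2)) := by
    have hKp := hKpos (d k) M
    rw [Real.sq_sqrt hKp.le, neg_div]
    gcongr
    have : (0 : ℝ) ≤ d k := Nat.cast_nonneg _
    nlinarith
  have := mul_le_mul hpre hexp (Real.exp_pos _).le (by linarith)
  linarith
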